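/- By a lattice we mean a discrete additive subgroup $\Gamma\subset\mathbb C$ of rank $2$. For a lattice $\Gamma$ put $$g_2(\Gamma)=\sum_{u\in\Gamma\setminus\{0\}}\frac{60}{u^4},\qquad g_3(\Gamma)=\sum_{u\in\Gamma\setminus\{0\}}\frac{140}{u^6},\qquad \Delta(\Gamma)=g_2(\Gamma)^3-27g_3(\Gamma)^2,$$ $$\wp(z;\Gamma)=\frac1{z^2}+\sum_{u\in\Gamma\setminus\{0\}}\left(\frac1{(z-u)^2}-\frac1{u^2}\right).$$ A subgroup $\Gamma'\subset\Gamma$ of index $2$ is called optimal if $|\Delta(\Gamma')|\le|\Delta(G)|$ for all subgroups $G\subset\Gamma$ of index $2$. A sequence $(a_n)_{n\ge0}$ of complex numbers converges quadratically fast if it converges to some $a\in\mathbb C$ and there exist $C,q>0$ such that $|a_n-a|\le C\exp(-q\,2^n)$ for all $n\ge 0$. Theorem. Let $\Gamma_0\supset\Gamma_1\supset\Gamma_2\supset\cdots$ be a sequence of subgroups of $\mathbb C$ such that $\Gamma_0$ is a lattice and, for each $n\ge0$, $\Gamma_{n+1}$ is an optimal subgroup of index $2$ in $\Gamma_n$.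 Then the sequences $(g_2(\Gamma_n))_{n\ge0}$ and $(g_3(\Gamma_n))_{n\ge0}$ converge quadratically fast. Moreover, for each $n\ge 0$, if $e_1,e_2,e_3$ are the distinct roots of $4x^3-g_2(\Gamma_n)x-g_3(\Gamma_n)$, numbered so that $e_1=\wp(\omega/2;\Gamma_n)$ for some $\omega\in\Gamma_{n+1}\setminus2\Gamma_n$, then $$g_2(\Gamma_{n+1})-g_2(\Gamma_n)=-\tfrac54(e_2-e_3)^2,\qquad g_3(\Gamma_{n+1})-g_3(\Gamma_n)=\tfrac{7e_1}{8}(e_2-e_3)^2 .$$ -/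

import Mathlib

noncomputable section

namespace Landen

/-- A lattice in `ℂ`: a discrete additive subgroup whose rank is exactly `2`. -/
def IsLattice (Γ : AddSubgroup ℂ) : Prop :=
  DiscreteTopology Γ ∧ Module.finrank ℤ Γ = 2

/-- `℘(z; Γ) = 1 / z² + ∑_{u ∈ Γ \ {0}} (1 / (z - u)² - 1 / u²)`. -/
def wp (Γ : AddSubgroup ℂ) (z : ℂ) : ℂ :=
  1 / z ^ 2 + ∑' u : ((Γ : Set ℂ) \ {0} : Set ℂ), (1 / (z - u) ^ 2 - 1 / (u : ℂ) ^ 2)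

/-- `g₂(Γ) = ∑_{u ∈ Γ \ {0}} 60 / u⁴`. -/
def g₂ (Γ : AddSubgroup ℂ) : ℂ :=
  ∑' u : ((Γ : Set ℂ) \ {0} : Set ℂ), 60 / (u : ℂ) ^ 4

/-- `g₃(Γ) = ∑_{u ∈ Γ \ {0}} 140 / u⁶`. -/
def g₃ (Γ : AddSubgroup ℂ) : ℂ :=
  ∑' u : ((Γ : Set ℂ) \ {0} : Set ℂ), 140 / (u : ℂ) ^ 6

/-- `Δ(Γ) = g₂(Γ)³ - 27 g₃(Γ)²`. -/
def discr (Γ : AddSubgroup ℂ) : ℂ :=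
  g₂ Γ ^ 3 - 27 * g₃ Γ ^ 2

/-- `G` is a subgroup of index `2` in `Γ`. -/
def IsIndexTwo (G Γ : AddSubgroup ℂ) : Prop :=
  G ≤ Γ ∧ G.relIndex Γ = 2

/-- `Γ'` is an optimal subgroup of index `2` in `Γ`: it has index `2`, and `|Δ(Γ')|` is minimal
among all subgroups of index `2` in `Γ`. -/
def IsOptimal (Γ' Γ : AddSubgroup ℂ) : Prop :=
  IsIndexTwo Γ' Γ ∧ ∀ G : AddSubgroup ℂ, IsIndexTwo G Γ → ‖discr Γ'‖ ≤ ‖discr G‖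

/-- `x` is a root of the polynomial `4 X³ - g₂(Γ) X - g₃(Γ)`. -/
def IsCubicRoot (Γ : AddSubgroup ℂ) (x : ℂ) : Prop :=
  4 * x ^ 3 - g₂ Γ * x - g₃ Γ = 0

/-- `(e₁, e₂, e₃)` consists of the three distinct roots of `4 X³ - g₂(Γ) X - g₃(Γ)`, and
`e₁ = ℘(ω / 2; Γ)` for some `ω ∈ Γ' \ 2Γ`. -/
def IsRootTriple (Γ Γ' : AddSubgroup ℂ) (e₁ e₂ e₃ : ℂ) : Prop :=
  (IsCubicRoot Γ e₁ ∧ IsCubicRoot Γ e₂ ∧ IsCubicRoot Γ e₃) ∧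
  (e₁ ≠ e₂ ∧ e₁ ≠ e₃ ∧ e₂ ≠ e₃) ∧
  ∃ ω ∈ Γ', (∀ γ ∈ Γ, ω ≠ 2 * γ) ∧ e₁ = wp Γ (ω / 2)

/-- A complex sequence converges quadratically fast if it converges to some `a` and
`|aₙ - a| ≤ C exp (-q 2ⁿ)` for all `n`, with some constants `C, q > 0`. -/
def ConvergesQuadraticallyFast (a : ℕ → ℂ) : Prop :=
  ∃ l : ℂ, Filter.Tendsto a Filter.atTop (nhds l) ∧
    ∃ C q : ℝ, 0 < C ∧ 0 < q ∧ ∀ n : ℕ, ‖a n - l‖ ≤ C * Real.exp (-q * 2 ^ n)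

end Landen

end

/-! An index-two subgroup `G` of `Γ` is `2Γ ∪ (2Γ - ω)` for some `ω ∈ G \ 2Γ`. The lattice sums of
`G` therefore split into a rescaled sum over `Γ` and a rescaled Taylor coefficient of `℘` at `ω /
2`. Since `℘' (ω / 2) = 0`, the differential equation turns that coefficient into a polynomial in
`e₁ = ℘(ω / 2)` and `g₂` (`isIndexTwo_invariants`). With Vieta's relations this gives the two
difference formulas and `16 Δ(G) = (e₂ - e₃)⁴ (e₁ - e₂)(e₁ - e₃)`. Comparing with the subgroups
attached to `e₂` and `e₃`, optimality forces `e₂ - e₃` to be a shortest root difference.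

The root differences for `G` are, up to sign, `αβ`, `((α + β) / 2)²` and `((α - β) / 2)²`, where `α²
= e₁ - e₂` and `β² = e₁ - e₃`: a step of the arithmetic-geometric mean. If `b` is the shortest
difference and `m` the smaller of the other two lengths, the next `b` is at most `b² / (8m)`, and
`m` drops by at most as much (`IsRootTriple.contraction`). So `m` stays away from zero, `b` decays
like `r ^ 2 ^ n`, and the increments of `g₂` and `g₃`, being multiples of `(e₂ - e₃)²`, are summable
at that rate. -/

namespace PeriodPair

open Filter Topology

variable (L : PeriodPair)

/-! ### The Weierstrass function at half periods -/

lemma tendsto_sq_mul_weierstrassP_zero :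
    Tendsto (fun z ↦ z ^ 2 * L.weierstrassP z) (𝓝[≠] 0) (𝓝 1) := by
  have hc : ContinuousAt (fun z ↦ z ^ 2 * L.weierstrassPExcept 0 z + 1) 0 := by
    have := (L.analyticAt_weierstrassPExcept 0).continuousAt
    fun_prop
  have ht : Tendsto (fun z ↦ z ^ 2 * L.weierstrassPExcept 0 z + 1) (𝓝[≠] 0) (𝓝 1) := by
    simpa using hc.tendsto.mono_left nhdsWithin_le_nhds
  refine ht.congr' ?_
  filter_upwards [self_mem_nhdsWithin] with z hz
  have hz : z ≠ 0 := hz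
  have := L.weierstrassPExcept_add 0 z
  simp only [ZeroMemClass.coe_zero, sub_zero] at this
  rw [← this]
  field_simp
  simp

lemma isPreconnected_compl_lattice : IsPreconnected ((L.lattice : Set ℂ)ᶜ) := by
  have : Countable L.lattice := L.latticeEquivProd.toEquiv.countable_iff.mpr inferInstance
  exact (Set.Countable.isConnected_compl_of_one_lt_rank (by simp)
    (Set.countable_coe_iff.mp this)).isPreconnected

lemma eventually_notMem_lattice (x : ℂ) : ∀ᶠ z in 𝓝[≠] x, z ∉ L.lattice := by
  filter_upwards [self_mem_nhdsWithin,
    mem_nhdsWithin_of_mem_nhds (L.compl_lattice_sdiff_singleton_mem_nhds x)] with z hz hz'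
  exact fun h ↦ hz' ⟨h, hz⟩

/-- Otherwise `℘' = 0` on the connected complement of the lattice by the identity theorem, so `℘` is
constant there, against its double pole at `0`. -/
lemma eventually_derivWeierstrassP_ne_zero {x : ℂ} (hx : x ∉ L.lattice) :
    ∀ᶠ z in 𝓝[≠] x, L.derivWeierstrassP z ≠ 0 := by
  refine (L.analyticOnNhd_derivWeierstrassP x hx).eventually_eq_zero_or_eventually_ne_zero.resolve_left
    fun h ↦ ?_
  have h0 : Set.EqOn L.derivWeierstrassP 0 (L.lattice : Set ℂ)ᶜ :=
    L.analyticOnNhd_derivWeierstrassP.eqOn_zero_of_preconnected_of_eventuallyEq_zero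
      L.isPreconnected_compl_lattice hx h
  obtain ⟨c, hc⟩ := L.isClosed_lattice.isOpen_compl.exists_is_const_of_deriv_eq_zero
    L.isPreconnected_compl_lattice L.differentiableOn_weierstrassP (by rwa [L.deriv_weierstrassP])
  have h1 : Tendsto (fun z : ℂ ↦ z ^ 2 * c) (𝓝[≠] 0) (𝓝 1) := by
    refine L.tendsto_sq_mul_weierstrassP_zero.congr' ?_
    filter_upwards [L.eventually_notMem_lattice 0] with z hz
    rw [hc z hz]
  have h2 : Tendsto (fun z : ℂ ↦ z ^ 2 * c) (𝓝[≠] 0) (𝓝 0) := by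
    have : ContinuousAt (fun z : ℂ ↦ z ^ 2 * c) 0 := by fun_prop
    simpa using this.tendsto.mono_left nhdsWithin_le_nhds
  exact one_ne_zero (tendsto_nhds_unique h1 h2)

/-- `℘'' = 6 ℘² - g₂ / 2`. -/
lemma deriv_derivWeierstrassP {x : ℂ} (hx : x ∉ L.lattice) :
    deriv L.derivWeierstrassP x = 6 * L.weierstrassP x ^ 2 - L.g₂ / 2 := by
  have hopen := L.isClosed_lattice.isOpen_compl
  have hP := L.analyticOnNhd_weierstrassP
  have hP' := L.analyticOnNhd_derivWeierstrassP
  -- Differentiating `℘'² = 4℘³ - g₂℘ - g₃` leaves a factor `℘'`, which can be cancelled only off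
  -- its zeros; continuity then covers `x` itself, in particular the half periods.
  have key : ∀ᶠ z in 𝓝[≠] x, deriv L.derivWeierstrassP z = 6 * L.weierstrassP z ^ 2 - L.g₂ / 2 := by
    filter_upwards [L.eventually_derivWeierstrassP_ne_zero hx,
      mem_nhdsWithin_of_mem_nhds (hopen.mem_nhds hx)] with z hz hzL
    have e : (fun w ↦ L.derivWeierstrassP w ^ 2) =ᶠ[𝓝 z]
        fun w ↦ 4 * L.weierstrassP w ^ 3 - L.g₂ * L.weierstrassP w - L.g₃ := by
      filter_upwards [hopen.mem_nhds hzL] with w hw using L.derivWeierstrassP_sq w hw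
    have h1 : HasDerivAt L.weierstrassP (L.derivWeierstrassP z) z := by
      have := (hP z hzL).differentiableAt.hasDerivAt
      rwa [L.deriv_weierstrassP] at this
    have h2 := (hP' z hzL).differentiableAt.hasDerivAt
    have h3 := (h2.pow 2).unique ((((h1.pow 3).const_mul 4).sub (h1.const_mul L.g₂)).sub_const L.g₃
      |>.congr_of_eventuallyEq e)
    norm_num at h3
    apply mul_left_cancel₀ hz
    linear_combination h3 / 2
  have c1 : ContinuousAt (deriv L.derivWeierstrassP) x := (hP' x hx).deriv.continuousAt
  have c2 : ContinuousAt (fun z ↦ 6 * L.weierstrassP z ^ 2 - L.g₂ / 2) x := by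
    have := (hP x hx).continuousAt
    fun_prop
  exact tendsto_nhds_unique ((c1.tendsto.mono_left nhdsWithin_le_nhds).congr' key)
    (c2.tendsto.mono_left nhdsWithin_le_nhds)

variable {L}

lemma derivWeierstrassP_eq_zero_of_two_mul_mem {u : ℂ} (hu : 2 * u ∈ L.lattice) :
    L.derivWeierstrassP u = 0 := by
  have h := L.derivWeierstrassP_add_coe (-u) ⟨2 * u, hu⟩
  rw [L.derivWeierstrassP_neg] at h
  simp only at h
  rw [show -u + 2 * u = u by ring] at h
  exact CharZero.eq_neg_self_iff.mp h

lemma sumInvPow_four_of_notMem {u : ℂ} (hu : u ∉ L.lattice) :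
    L.sumInvPow u 4 = L.weierstrassP u ^ 2 - L.g₂ / 12 := by
  have h := L.iteratedDeriv_weierstrassPExcept_self u (n := 2)
  rw [L.weierstrassPExcept_of_notMem u hu, iteratedDeriv_succ, iteratedDeriv_one,
    L.deriv_weierstrassP, L.deriv_derivWeierstrassP hu] at h
  norm_num [Nat.factorial] at h
  linear_combination -h / 6

/-- The sum is `℘⁗(u) / 5!`, and `℘⁗ = 12 (℘'² + ℘ ℘'')` with `℘'(u) = 0`. -/
lemma sumInvPow_six_of_two_mul_mem {u : ℂ} (hu : u ∉ L.lattice) (hu2 : 2 * u ∈ L.lattice) :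
    10 * L.sumInvPow u 6 = L.weierstrassP u * (6 * L.weierstrassP u ^ 2 - L.g₂ / 2) := by
  have hopen := L.isClosed_lattice.isOpen_compl
  have h := L.iteratedDeriv_weierstrassPExcept_self u (n := 4)
  have h1 : ∀ z ∉ L.lattice, HasDerivAt L.weierstrassP (L.derivWeierstrassP z) z := fun z hz ↦ by
    have := (L.analyticOnNhd_weierstrassP z hz).differentiableAt.hasDerivAt
    rwa [L.deriv_weierstrassP] at this
  have h2 : ∀ z ∉ L.lattice, HasDerivAt L.derivWeierstrassP (6 * L.weierstrassP z ^ 2 - L.g₂ / 2) z :=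
    fun z hz ↦ by
      rw [← L.deriv_derivWeierstrassP hz]
      exact (L.analyticOnNhd_derivWeierstrassP z hz).differentiableAt.hasDerivAt
  have e2 : deriv L.derivWeierstrassP =ᶠ[𝓝 u] fun z ↦ 6 * L.weierstrassP z ^ 2 - L.g₂ / 2 := by
    filter_upwards [hopen.mem_nhds hu] with z hz using L.deriv_derivWeierstrassP hz
  have e3 : deriv (deriv L.derivWeierstrassP) =ᶠ[𝓝 u]
      fun z ↦ 12 * (L.weierstrassP z * L.derivWeierstrassP z) := by
    refine e2.deriv.trans ?_
    filter_upwards [hopen.mem_nhds hu] with z hz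
    rw [((((h1 z hz).fun_pow 2).const_mul 6).sub_const (L.g₂ / 2)).deriv]
    norm_num
    ring
  rw [L.weierstrassPExcept_of_notMem u hu, iteratedDeriv_succ, iteratedDeriv_succ, iteratedDeriv_succ,
    iteratedDeriv_one, L.deriv_weierstrassP, e3.deriv_eq,
    (((h1 u hu).fun_mul (h2 u hu)).const_mul 12).deriv,
    derivWeierstrassP_eq_zero_of_two_mul_mem hu2] at h
  norm_num [Nat.factorial] at h
  linear_combination -h / 12

lemma tendsto_weierstrassP_sub_div_sq {u : ℂ} (hu : u ∉ L.lattice) (hu2 : 2 * u ∈ L.lattice) :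
    Tendsto (fun z ↦ (L.weierstrassP (z + u) - L.weierstrassP u) / z ^ 2) (𝓝[≠] 0)
      (𝓝 (3 * L.weierstrassP u ^ 2 - L.g₂ / 4)) := by
  have h0 := L.hasFPowerSeriesAt_weierstrassPExcept u
  rw [L.weierstrassPExcept_of_notMem u hu] at h0
  -- Two divided differences at `u` leave a continuous function whose value there is the second
  -- Taylor coefficient.
  have h := h0.has_fpower_series_iterate_dslope_fslope 2
  have hval : (Function.swap dslope u)^[2] L.weierstrassP u = 3 * L.weierstrassP u ^ 2 - L.g₂ / 4 := by
    rw [← h.coeff_zero 1, ← FormalMultilinearSeries.coeff, FormalMultilinearSeries.coeff_iterate_fslope]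
    simp [sumInvPow_four_of_notMem hu]
    ring
  have hshift : Tendsto (fun z : ℂ ↦ z + u) (𝓝[≠] 0) (𝓝 u) := by
    have : ContinuousAt (fun z : ℂ ↦ z + u) 0 := by fun_prop
    simpa using this.tendsto.mono_left nhdsWithin_le_nhds
  rw [← hval]
  refine (h.continuousAt.tendsto.comp hshift).congr' ?_
  filter_upwards [self_mem_nhdsWithin] with z hz
  have hz : z ≠ 0 := hz
  have hd : deriv L.weierstrassP u = 0 := by
    rw [L.deriv_weierstrassP, derivWeierstrassP_eq_zero_of_two_mul_mem hu2]
  simp only [Function.comp_apply, Function.iterate_succ, Function.iterate_zero, id, Function.swap]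
  rw [dslope_of_ne _ (by simpa using hz), slope_def_field, dslope_same, hd,
    dslope_of_ne _ (by simpa using hz), slope_def_field, sub_zero, add_sub_cancel_right, div_div, sq]

lemma weierstrassP_add_two_mul {u : ℂ} (hu2 : 2 * u ∈ L.lattice) (z : ℂ) :
    L.weierstrassP (z + u + u) = L.weierstrassP z := by
  have := L.weierstrassP_add_coe z ⟨2 * u, hu2⟩
  rw [← this]
  congr 1
  ring

/-- Translation by a half period `u` acts on the values of `℘` by the involution
`x ↦ ℘(u) + (3 ℘(u)² - g₂ / 4) / (x - ℘(u))`. -/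
lemma weierstrassP_sub_mul_weierstrassP_add_sub {u : ℂ} (hu : u ∉ L.lattice)
    (hu2 : 2 * u ∈ L.lattice) {z : ℂ} (hz : z ∉ L.lattice) (hzu : z + u ∉ L.lattice) :
    (L.weierstrassP z - L.weierstrassP u) * (L.weierstrassP (z + u) - L.weierstrassP u) =
      3 * L.weierstrassP u ^ 2 - L.g₂ / 4 := by
  classical
  set e := L.weierstrassP u
  set C := 3 * e ^ 2 - L.g₂ / 4 with hC
  -- The product with its singularities filled in. At `0` the double pole of the first factor meets
  -- the double zero of the second, with limit `C`; the symmetry `w ↦ w + u` handles the other class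
  -- of poles, and Liouville makes `h` constant.
  let h : ℂ → ℂ := fun w ↦ if w ∈ L.lattice ∨ w + u ∈ L.lattice then C else
    (L.weierstrassP w - e) * (L.weierstrassP (w + u) - e)
  have hopen := L.isClosed_lattice.isOpen_compl
  have mem_add {w l : ℂ} (hl : l ∈ L.lattice) : w + l ∈ L.lattice ↔ w ∈ L.lattice :=
    L.lattice.toAddSubgroup.add_mem_cancel_right hl
  have hper : ∀ w l, l ∈ L.lattice → h (w + l) = h w := fun w l hl ↦ by
    have e1 : L.weierstrassP (w + l) = L.weierstrassP w := L.weierstrassP_add_coe w ⟨l, hl⟩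
    have e2 : L.weierstrassP (w + l + u) = L.weierstrassP (w + u) := by
      rw [add_right_comm]; exact L.weierstrassP_add_coe (w + u) ⟨l, hl⟩
    have e3 : w + l + u ∈ L.lattice ↔ w + u ∈ L.lattice := by rw [add_right_comm, mem_add hl]
    simp only [h, e1, e2, e3, mem_add hl]
  have hperu : ∀ w, h (w + u) = h w := fun w ↦ by
    have e1 : w + u + u ∈ L.lattice ↔ w ∈ L.lattice := by
      rw [add_assoc, ← two_mul, mem_add hu2]
    simp only [h, weierstrassP_add_two_mul hu2, e1, or_comm (a := w ∈ L.lattice),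
      mul_comm (L.weierstrassP w - e)]
  have hreg : ∀ w, w ∉ L.lattice → w + u ∉ L.lattice → AnalyticAt ℂ h w := fun w hw hwu ↦ by
    have a1 := L.analyticOnNhd_weierstrassP w hw
    have a2 : AnalyticAt ℂ (fun w ↦ L.weierstrassP (w + u)) w :=
      (L.analyticOnNhd_weierstrassP (w + u) hwu).fun_comp (f := fun w ↦ w + u) (by fun_prop)
    have a3 : AnalyticAt ℂ (fun w ↦ (L.weierstrassP w - e) * (L.weierstrassP (w + u) - e)) w := by
      fun_prop
    refine a3.congr ?_
    have hc : ContinuousAt (fun w : ℂ ↦ w + u) w := by fun_prop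
    filter_upwards [hopen.mem_nhds hw, hc.preimage_mem_nhds (hopen.mem_nhds hwu)] with v hv hvu
    exact (if_neg (not_or.mpr ⟨hv, hvu⟩)).symm
  have hev : ∀ᶠ w in 𝓝[≠] (0 : ℂ), w ∉ L.lattice ∧ w + u ∉ L.lattice := by
    have hc : ContinuousAt (fun w : ℂ ↦ w + u) 0 := by fun_prop
    filter_upwards [L.eventually_notMem_lattice 0,
      mem_nhdsWithin_of_mem_nhds (hc.preimage_mem_nhds (hopen.mem_nhds (by simpa using hu)))]
      with v hv hvu using ⟨hv, hvu⟩
  have hzero : AnalyticAt ℂ h 0 := by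
    refine Complex.analyticAt_of_differentiable_on_punctured_nhds_of_continuousAt ?_ ?_
    · filter_upwards [hev] with w hw using (hreg w hw.1 hw.2).differentiableAt
    · rw [continuousAt_iff_punctured_nhds]
      have t1 : Tendsto (fun w ↦ w ^ 2 * (L.weierstrassP w - e)) (𝓝[≠] 0) (𝓝 1) := by
        have : ContinuousAt (fun w : ℂ ↦ w ^ 2 * e) 0 := by fun_prop
        have := L.tendsto_sq_mul_weierstrassP_zero.sub (this.tendsto.mono_left nhdsWithin_le_nhds)
        simpa [mul_sub] using this
      have t2 := t1.mul (tendsto_weierstrassP_sub_div_sq hu hu2)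
      have h00 : h 0 = C := by simp [h]
      rw [h00, ← one_mul C]
      refine t2.congr' ?_
      filter_upwards [hev, self_mem_nhdsWithin] with w hw hw0
      have hw0 : w ≠ 0 := hw0
      simp only [h]
      rw [if_neg (not_or.mpr hw)]
      field_simp
      rfl
  have htrans : ∀ w v, (∀ x, h (x + v) = h x) → AnalyticAt ℂ h (w + v) → AnalyticAt ℂ h w :=
    fun w v hv ha ↦ by
      have := ha.fun_comp (f := fun x ↦ x + v) (by fun_prop)
      simpa only [hv] using! this
  have hlat : ∀ w ∈ L.lattice, AnalyticAt ℂ h w := fun w hw ↦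
    htrans w (-w) (fun x ↦ hper x _ (neg_mem hw)) (by simpa using hzero)
  have hdiff : Differentiable ℂ h := fun w ↦ by
    by_cases hw : w ∈ L.lattice
    · exact (hlat w hw).differentiableAt
    by_cases hwu : w + u ∈ L.lattice
    · exact (htrans w u hperu (hlat _ hwu)).differentiableAt
    · exact (hreg w hw hwu).differentiableAt
  have hconst := hdiff.apply_eq_apply_of_bounded
    (IsZLattice.isCompact_range_of_periodic L.lattice h hdiff.continuous hper).isBounded z 0
  simpa [h, hz, hzu] using hconst

/-- If the constant of the involution were zero, the factor `℘(z) - ℘(u)`, nonzero near the pole at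
`0`, would force `℘` to be constant near `u`. Nonvanishing separates the values of `℘` at distinct
half periods. -/
lemma weierstrassP_half_ne_zero {u : ℂ} (hu : u ∉ L.lattice) (hu2 : 2 * u ∈ L.lattice) :
    3 * L.weierstrassP u ^ 2 - L.g₂ / 4 ≠ 0 := by
  intro h0
  have hu' : ∀ᶠ z in 𝓝[≠] (0 : ℂ), L.weierstrassP z - L.weierstrassP u ≠ 0 := by
    have t := L.tendsto_sq_mul_weierstrassP_zero
    have : ContinuousAt (fun w : ℂ ↦ w ^ 2 * L.weierstrassP u) 0 := by fun_prop
    have t := t.sub (this.tendsto.mono_left nhdsWithin_le_nhds)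
    filter_upwards [t.eventually_ne (b₂ := 0) (by simp)] with z hz h
    apply hz
    rw [← mul_sub, h, mul_zero]
  have ht : Tendsto (fun w : ℂ ↦ w - u) (𝓝[≠] u) (𝓝[≠] 0) := by
    refine tendsto_nhdsWithin_iff.mpr ⟨?_, ?_⟩
    · have : ContinuousAt (fun w : ℂ ↦ w - u) u := by fun_prop
      simpa using this.tendsto.mono_left nhdsWithin_le_nhds
    · filter_upwards [self_mem_nhdsWithin] with w hw
      simpa [sub_eq_zero] using hw
  have hev : ∀ᶠ w in 𝓝[≠] u, L.weierstrassP w = L.weierstrassP u := by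
    filter_upwards [ht.eventually (hu'.and (L.eventually_notMem_lattice 0)),
      mem_nhdsWithin_of_mem_nhds (L.isClosed_lattice.isOpen_compl.mem_nhds hu)] with w hw hwL
    have := weierstrassP_sub_mul_weierstrassP_add_sub hu hu2 hw.2 (by simpa using hwL)
    rw [h0, sub_add_cancel] at this
    exact sub_eq_zero.mp ((mul_eq_zero.mp this).resolve_left hw.1)
  have hev2 : L.weierstrassP =ᶠ[𝓝 u] fun _ ↦ L.weierstrassP u := by
    filter_upwards [eventually_nhdsWithin_iff.mp hev] with w hw
    by_cases h : w = u
    · rw [h]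
    · exact hw h
  have hd := hev2.deriv
  rw [L.deriv_weierstrassP] at hd
  obtain ⟨w, hw1, hw2⟩ := ((L.eventually_derivWeierstrassP_ne_zero hu).and
    (hd.filter_mono nhdsWithin_le_nhds)).exists
  exact hw1 (by simpa using hw2)

lemma weierstrassP_ne_of_two_mul_mem {u v : ℂ} (hu : u ∉ L.lattice) (hu2 : 2 * u ∈ L.lattice)
    (hv : v ∉ L.lattice) (huv : v + u ∉ L.lattice) :
    L.weierstrassP v ≠ L.weierstrassP u := fun h ↦
  weierstrassP_half_ne_zero hu hu2 (by
    rw [← weierstrassP_sub_mul_weierstrassP_add_sub hu hu2 hv huv, h, sub_self, zero_mul])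

end PeriodPair

/-! ### Index-two subgroups and classes modulo `2Γ` -/

namespace Landen

open Module

/-- The subgroup `2Γ`. -/
noncomputable def twice (Γ : AddSubgroup ℂ) : AddSubgroup ℂ := Γ.map (nsmulAddMonoidHom 2)

lemma mem_twice {Γ : AddSubgroup ℂ} {x : ℂ} : x ∈ twice Γ ↔ ∃ γ ∈ Γ, x = 2 * γ := by
  simp [twice, AddSubgroup.mem_map, eq_comm]

lemma notMem_twice {Γ : AddSubgroup ℂ} {x : ℂ} : x ∉ twice Γ ↔ ∀ γ ∈ Γ, x ≠ 2 * γ := by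
  simp [mem_twice]

lemma twice_le (Γ : AddSubgroup ℂ) : twice Γ ≤ Γ := fun x hx ↦ by
  obtain ⟨γ, hγ, rfl⟩ := mem_twice.mp hx
  rw [two_mul]
  exact add_mem hγ hγ

lemma IsLattice.exists_periodPair {Γ : AddSubgroup ℂ} (h : IsLattice Γ) :
    ∃ L : PeriodPair, L.lattice.toAddSubgroup = Γ := by
  obtain ⟨hd, hr⟩ := h
  let M : Submodule ℤ ℂ := AddSubgroup.toIntSubmodule Γ
  have hM : M.toAddSubgroup = Γ := by ext; rfl
  have hdM : DiscreteTopology M := hd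
  have hrM : finrank ℤ M = 2 := hr
  have hspan : Submodule.span ℤ (M : Set ℂ) = M := Submodule.span_eq M
  -- Discreteness makes the real rank of the span equal to the integral rank, so `Γ` spans `ℂ`.
  have hrR : finrank ℝ (Submodule.span ℝ (M : Set ℂ)) = 2 := by
    have := Real.finrank_eq_int_finrank_of_discrete (s := (M : Set ℂ)) (by rwa [hspan])
    rw [Set.finrank, Set.finrank, hspan, hrM] at this
    exact this
  have hZ : IsZLattice ℝ M :=
    ⟨Submodule.eq_top_of_finrank_eq (by rw [hrR, Complex.finrank_real_complex])⟩
  have := ZLattice.module_free ℝ M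
  have := ZLattice.module_finite ℝ M
  let b : Basis (Fin 2) ℤ M := (finBasis ℤ M).reindex (finCongr hrM)
  have hb := (b.ofZLatticeBasis ℝ M).linearIndependent
  have hbs := b.ofZLatticeBasis_span ℝ M
  have hfun : (b.ofZLatticeBasis ℝ M : Fin 2 → ℂ) = ![(b 0 : ℂ), (b 1 : ℂ)] := by
    ext i; fin_cases i <;> simp
  rw [hfun] at hb hbs
  refine ⟨⟨b 0, b 1, hb⟩, ?_⟩
  rw [← hM, PeriodPair.lattice]
  refine congrArg Submodule.toAddSubgroup (Eq.trans ?_ hbs)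
  simp [Set.pair_comm]

lemma IsLattice.of_isIndexTwo {Γ G : AddSubgroup ℂ} (h : IsLattice Γ) (hG : IsIndexTwo G Γ) :
    IsLattice G := by
  obtain ⟨L, rfl⟩ := h.exists_periodPair
  refine ⟨?_, ?_⟩
  · have := h.1
    exact DiscreteTopology.of_subset (s := (L.lattice.toAddSubgroup : Set ℂ)) this hG.1
  · have : Module.Finite ℤ L.lattice.toAddSubgroup := ZLattice.module_finite ℝ L.lattice
    have : G.IsFiniteRelIndex L.lattice.toAddSubgroup := ⟨by rw [hG.2]; norm_num⟩
    rw [AddSubgroup.finrank_eq_of_isFiniteRelIndex hG.1, h.2]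

lemma IsLattice.relIndex_twice {Γ : AddSubgroup ℂ} (h : IsLattice Γ) :
    (twice Γ).relIndex Γ = 4 := by
  have h2 := h.2
  obtain ⟨L, rfl⟩ := h.exists_periodPair
  have : Module.Finite ℤ L.lattice := ZLattice.module_finite ℝ L.lattice
  have : Module.Free ℤ L.lattice := ZLattice.module_free ℝ L.lattice
  have : Module.Finite ℤ L.lattice.toAddSubgroup.toIntSubmodule := ‹Module.Finite ℤ L.lattice›
  have : Module.Free ℤ L.lattice.toAddSubgroup.toIntSubmodule := ‹Module.Free ℤ L.lattice›
  rw [twice, AddSubgroup.relIndex_map_nsmul, h2]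
  norm_num

lemma IsIndexTwo.twice_le {Γ G : AddSubgroup ℂ} (hG : IsIndexTwo G Γ) : twice Γ ≤ G := fun x hx ↦ by
  obtain ⟨γ, hγ, rfl⟩ := mem_twice.mp hx
  have := AddSubgroup.two_smul_mem_of_index_two (H := G.addSubgroupOf Γ) hG.2 ⟨γ, hγ⟩
  simpa [AddSubgroup.mem_addSubgroupOf] using this

lemma IsIndexTwo.relIndex_twice {Γ G : AddSubgroup ℂ} (h : IsLattice Γ) (hG : IsIndexTwo G Γ) :
    (twice Γ).relIndex G = 2 := by
  have := AddSubgroup.relIndex_mul_relIndex _ _ _ hG.twice_le hG.1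
  rw [hG.2, h.relIndex_twice] at this
  omega

lemma IsIndexTwo.exists_notMem_twice {Γ G : AddSubgroup ℂ} (h : IsLattice Γ)
    (hG : IsIndexTwo G Γ) : ∃ ω ∈ G, ω ∉ twice Γ := by
  obtain ⟨a, ha, ha', -⟩ :=
    AddSubgroup.relIndex_eq_two_iff_exists_notMem_and.mp (hG.relIndex_twice h)
  exact ⟨a, ha, ha'⟩

lemma IsIndexTwo.mem_twice_or_add_mem_twice {Γ G : AddSubgroup ℂ} (h : IsLattice Γ)
    (hG : IsIndexTwo G Γ) {ω g : ℂ} (hω : ω ∈ G) (hω' : ω ∉ twice Γ) (hg : g ∈ G) :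
    g ∈ twice Γ ∨ g + ω ∈ twice Γ := by
  have := AddSubgroup.add_mem_iff_of_index_two (H := (twice Γ).addSubgroupOf G)
    (hG.relIndex_twice h) (a := ⟨g, hg⟩) (b := ⟨ω, hω⟩)
  simp only [AddSubgroup.mem_addSubgroupOf, AddSubgroup.coe_add] at this
  tauto

lemma exists_isIndexTwo_of_notMem_twice {Γ : AddSubgroup ℂ} (h : IsLattice Γ) {η : ℂ} (hη : η ∈ Γ)
    (hη' : η ∉ twice Γ) : ∃ G, IsIndexTwo G Γ ∧ η ∈ G := by
  have hle : twice Γ ⊔ AddSubgroup.zmultiples η ≤ Γ :=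
    sup_le (twice_le Γ) (by simpa [AddSubgroup.zmultiples_le])
  have hmem : η ∈ twice Γ ⊔ AddSubgroup.zmultiples η :=
    (le_sup_right : _ ≤ twice Γ ⊔ _) (AddSubgroup.mem_zmultiples η)
  refine ⟨twice Γ ⊔ AddSubgroup.zmultiples η, ⟨hle, ?_⟩, hmem⟩
  have h2 : (twice Γ).relIndex (twice Γ ⊔ AddSubgroup.zmultiples η) = 2 := by
    refine AddSubgroup.relIndex_eq_two_iff_exists_notMem_and.mpr ⟨η, hmem, hη', fun b hb ↦ ?_⟩
    obtain ⟨x, hx, y, hy, rfl⟩ := AddSubgroup.mem_sup.mp hb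
    obtain ⟨k, rfl⟩ := AddSubgroup.mem_zmultiples_iff.mp hy
    have key (m : ℤ) : x + (m * (2 * η)) ∈ twice Γ := by
      refine add_mem hx (mem_twice.mpr ⟨m • η, zsmul_mem hη m, ?_⟩)
      simp; ring
    rcases Int.even_or_odd' k with ⟨m, rfl | rfl⟩
    · right
      convert key m using 2
      simp; ring
    · left
      convert key (m + 1) using 1
      simp; ring
  have := AddSubgroup.relIndex_mul_relIndex _ _ _ (le_sup_left : twice Γ ≤ twice Γ ⊔ _) hle
  rw [h2, h.relIndex_twice] at this
  omega

/-! ### Lattice sums over a subgroup -/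

section Sums

/-- Applies to the summands here because division by zero yields `0`, so restoring the term at `0`
changes nothing. -/
lemma tsum_sdiff_zero (Γ : AddSubgroup ℂ) {f : ℂ → ℂ} (hf : f 0 = 0) :
    ∑' u : ((Γ : Set ℂ) \ {0} : Set ℂ), f u = ∑' u : Γ, f u := by
  refine (tsum_subtype _ f).trans (Eq.trans ?_ (tsum_subtype (Γ : Set ℂ) f).symm)
  refine tsum_congr fun x ↦ ?_
  by_cases hx : x = 0
  · simp [hx, hf]
  by_cases hxΓ : x ∈ Γ
  · rw [Set.indicator_of_mem (by exact ⟨hxΓ, hx⟩), Set.indicator_of_mem (by exact hxΓ)]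
  · rw [Set.indicator_of_notMem (fun h ↦ hxΓ h.1), Set.indicator_of_notMem (by exact hxΓ)]

variable (L : PeriodPair)

lemma g₂_toAddSubgroup : g₂ L.lattice.toAddSubgroup = L.g₂ := by
  rw [g₂, tsum_sdiff_zero _ (f := fun u ↦ 60 / u ^ 4) (by simp), PeriodPair.g₂, PeriodPair.G,
    ← tsum_mul_left]
  rfl

lemma g₃_toAddSubgroup : g₃ L.lattice.toAddSubgroup = L.g₃ := by
  rw [g₃, tsum_sdiff_zero _ (f := fun u ↦ 140 / u ^ 6) (by simp), PeriodPair.g₃, PeriodPair.G,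
    ← tsum_mul_left]
  rfl

lemma wp_toAddSubgroup (z : ℂ) : wp L.lattice.toAddSubgroup z = L.weierstrassP z := by
  classical
  have h0 := L.weierstrassPExcept_add 0 z
  simp only [ZeroMemClass.coe_zero, sub_zero] at h0
  have h1 := tsum_sdiff_zero L.lattice.toAddSubgroup
    (f := fun u ↦ if u = 0 then 0 else 1 / (z - u) ^ 2 - 1 / u ^ 2) (by simp)
  rw [wp, ← h0, add_comm]
  congr 1
  · refine Eq.trans (tsum_congr fun u ↦ ?_) (h1.trans ?_)
    · exact (if_neg u.2.2).symm
    · rfl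
  · simp

lemma hasSum_inv_pow_of_isIndexTwo {G : AddSubgroup ℂ} (h : IsLattice L.lattice.toAddSubgroup)
    (hG : IsIndexTwo G L.lattice.toAddSubgroup) {ω : ℂ} (hω : ω ∈ G)
    (hω' : ω ∉ twice L.lattice.toAddSubgroup) {r : ℕ} (hr : 2 < r) :
    HasSum (fun g : G ↦ ((g : ℂ) ^ r)⁻¹) ((2 ^ r)⁻¹ * (L.G r + L.sumInvPow (ω / 2) r)) := by
  have mem (l : L.lattice) : 2 * (l : ℂ) ∈ G := hG.twice_le (mem_twice.mpr ⟨l, l.2, rfl⟩)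
  -- The cosets `2Γ` and `2Γ - ω` exhaust `G`; the sign of `ω` matches the terms `l - ω / 2` of
  -- `sumInvPow`.
  let f : L.lattice ⊕ L.lattice → G := Sum.elim (fun l ↦ ⟨2 * l, mem l⟩)
    (fun l ↦ ⟨2 * l - ω, sub_mem (mem l) hω⟩)
  have hf : Function.Bijective f := by
    constructor
    · rintro (l | l) (l' | l') hl
      · simpa [f] using hl
      · refine absurd (mem_twice.mpr ⟨l' - l, sub_mem l'.2 l.2, ?_⟩) hω'
        have : 2 * (l : ℂ) = 2 * l' - ω := congrArg Subtype.val hl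
        linear_combination this
      · refine absurd (mem_twice.mpr ⟨l - l', sub_mem l.2 l'.2, ?_⟩) hω'
        have : 2 * (l : ℂ) - ω = 2 * l' := congrArg Subtype.val hl
        linear_combination -this
      · simpa [f] using hl
    · rintro ⟨g, hg⟩
      rcases hG.mem_twice_or_add_mem_twice h hω hω' hg with hg' | hg'
      · obtain ⟨γ, hγ, e⟩ := mem_twice.mp hg'
        exact ⟨.inl ⟨γ, hγ⟩, Subtype.ext e.symm⟩
      · obtain ⟨γ, hγ, e⟩ := mem_twice.mp hg'
        exact ⟨.inr ⟨γ, hγ⟩, Subtype.ext (by simp [f, ← e])⟩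
  rw [← (Equiv.ofBijective f hf).hasSum_iff, mul_add]
  have h1 := (L.hasSum_sumInvPow 0 hr).mul_left (2 ^ r)⁻¹
  have h2 := (L.hasSum_sumInvPow (ω / 2) hr).mul_left (2 ^ r)⁻¹
  rw [L.sumInvPow_zero] at h1
  refine HasSum.sum (Eq.subst (motive := (HasSum · _)) (funext fun l ↦ ?_) h1)
    (Eq.subst (motive := (HasSum · _)) (funext fun l ↦ ?_) h2)
  · simp [f, mul_pow, mul_comm]
  · simp only [Function.comp_apply, Equiv.ofBijective_apply, Sum.elim_inr, f]
    rw [show 2 * (l : ℂ) - ω = 2 * (l - ω / 2) by ring, mul_pow, mul_inv]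

end Sums

/-! ### Roots of the cubic, invariants of the subgroup, and optimality -/

section Roots

lemma isIndexTwo_invariants {Γ G : AddSubgroup ℂ} (h : IsLattice Γ) (hG : IsIndexTwo G Γ) {ω : ℂ}
    (hω : ω ∈ G) (hω' : ω ∉ twice Γ) :
    4 * g₂ G = 15 * wp Γ (ω / 2) ^ 2 - g₂ Γ ∧
      8 * g₃ G = 11 * wp Γ (ω / 2) ^ 3 - g₂ Γ * wp Γ (ω / 2) := by
  obtain ⟨L, rfl⟩ := h.exists_periodPair
  have hu : ω / 2 ∉ L.lattice := fun hu ↦ hω' (mem_twice.mpr ⟨ω / 2, hu, by ring⟩)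
  have hu2 : 2 * (ω / 2) ∈ L.lattice := by
    rw [mul_div_cancel₀ _ two_ne_zero]
    exact hG.1 hω
  have h4 := (hasSum_inv_pow_of_isIndexTwo L h hG hω hω' (r := 4) (by norm_num)).mul_left 60
  have h6 := (hasSum_inv_pow_of_isIndexTwo L h hG hω hω' (r := 6) (by norm_num)).mul_left 140
  have s4 := PeriodPair.sumInvPow_four_of_notMem hu
  have s6 := PeriodPair.sumInvPow_six_of_two_mul_mem hu hu2
  have hP := L.derivWeierstrassP_sq _ hu
  rw [PeriodPair.derivWeierstrassP_eq_zero_of_two_mul_mem hu2] at hP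
  have e4 : g₂ G = _ := (tsum_sdiff_zero G (f := fun u ↦ 60 / u ^ 4) (by simp)).trans h4.tsum_eq
  have e6 : g₃ G = _ := (tsum_sdiff_zero G (f := fun u ↦ 140 / u ^ 6) (by simp)).trans h6.tsum_eq
  have hg2 : L.g₂ = 60 * L.G 4 := rfl
  have hg3 : L.g₃ = 140 * L.G 6 := rfl
  rw [e4, e6, wp_toAddSubgroup, g₂_toAddSubgroup]
  constructor
  · linear_combination 15 * s4 - hg2 / 4
  -- `hP` is the cubic equation for `℘(ω / 2)`; it eliminates `g₃`.
  · linear_combination (7 / 4) * s6 - (1 / 8) * hg3 + (1 / 8) * hP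

lemma isCubicRoot_wp {Γ : AddSubgroup ℂ} (h : IsLattice Γ) {η : ℂ} (hη : η ∈ Γ)
    (hη' : η ∉ twice Γ) : IsCubicRoot Γ (wp Γ (η / 2)) := by
  obtain ⟨L, rfl⟩ := h.exists_periodPair
  have hu : η / 2 ∉ L.lattice := fun hu ↦ hη' (mem_twice.mpr ⟨η / 2, hu, by ring⟩)
  have hu2 : 2 * (η / 2) ∈ L.lattice := by
    rw [mul_div_cancel₀ _ two_ne_zero]
    exact hη
  have hP := L.derivWeierstrassP_sq _ hu
  rw [PeriodPair.derivWeierstrassP_eq_zero_of_two_mul_mem hu2] at hP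
  rw [IsCubicRoot, wp_toAddSubgroup, g₂_toAddSubgroup, g₃_toAddSubgroup, ← hP]
  norm_num

lemma IsLattice.exists_distinct_half_period_values {Γ : AddSubgroup ℂ} (h : IsLattice Γ) :
    ∃ η₁ ∈ Γ, ∃ η₂ ∈ Γ, ∃ η₃ ∈ Γ, (η₁ ∉ twice Γ ∧ η₂ ∉ twice Γ ∧ η₃ ∉ twice Γ) ∧
      wp Γ (η₁ / 2) ≠ wp Γ (η₂ / 2) ∧ wp Γ (η₁ / 2) ≠ wp Γ (η₃ / 2) ∧
      wp Γ (η₂ / 2) ≠ wp Γ (η₃ / 2) := by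
  obtain ⟨L, rfl⟩ := h.exists_periodPair
  have m1 := L.ω₁_mem_lattice
  have m2 := L.ω₂_mem_lattice
  have n1 := L.ω₁_div_two_notMem_lattice
  have n2 := L.ω₂_div_two_notMem_lattice
  have n3 : (L.ω₁ + L.ω₂) / 2 ∉ L.lattice := by
    have := (L.mul_ω₁_add_mul_ω₂_mem_lattice (α := 1 / 2) (β := 1 / 2)).not.mpr (by norm_num)
    convert this using 2
    push_cast
    ring
  have n13 : (L.ω₁ + L.ω₂) / 2 + L.ω₁ / 2 ∉ L.lattice := fun hm ↦ n2 (by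
    convert sub_mem hm m1 using 1; ring)
  have n23 : (L.ω₁ + L.ω₂) / 2 + L.ω₂ / 2 ∉ L.lattice := fun hm ↦ n1 (by
    convert sub_mem hm m2 using 1; ring)
  have n12 : L.ω₂ / 2 + L.ω₁ / 2 ∉ L.lattice := by
    convert n3 using 2; ring
  have half {x : ℂ} (hx : x / 2 ∉ L.lattice) : x ∉ twice L.lattice.toAddSubgroup := fun hm ↦ by
    obtain ⟨γ, hγ, rfl⟩ := mem_twice.mp hm
    exact hx (by rwa [mul_div_cancel_left₀ _ two_ne_zero])
  have two {x : ℂ} (hx : x ∈ L.lattice) : 2 * (x / 2) ∈ L.lattice := by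
    rwa [mul_div_cancel₀ _ two_ne_zero]
  simp only [wp_toAddSubgroup]
  exact ⟨L.ω₁, m1, L.ω₂, m2, L.ω₁ + L.ω₂, add_mem m1 m2, ⟨half n1, half n2, half n3⟩,
    (PeriodPair.weierstrassP_ne_of_two_mul_mem n1 (two m1) n2 n12).symm,
    (PeriodPair.weierstrassP_ne_of_two_mul_mem n1 (two m1) n3 n13).symm,
    (PeriodPair.weierstrassP_ne_of_two_mul_mem n2 (two m2) n3 n23).symm⟩

lemma vieta_of_isCubicRoot {Γ : AddSubgroup ℂ} {x y z : ℂ} (hx : IsCubicRoot Γ x)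
    (hy : IsCubicRoot Γ y) (hz : IsCubicRoot Γ z) (hxy : x ≠ y) (hxz : x ≠ z) (hyz : y ≠ z) :
    x + y + z = 0 ∧ g₂ Γ = -4 * (x * y + x * z + y * z) ∧ g₃ Γ = 4 * (x * y * z) := by
  simp only [IsCubicRoot] at hx hy hz
  have a1 : 4 * (x ^ 2 + x * y + y ^ 2) = g₂ Γ := by
    apply mul_left_cancel₀ (sub_ne_zero.mpr hxy)
    linear_combination hx - hy
  have a2 : 4 * (x ^ 2 + x * z + z ^ 2) = g₂ Γ := by
    apply mul_left_cancel₀ (sub_ne_zero.mpr hxz)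
    linear_combination hx - hz
  have hs : x + y + z = 0 := by
    apply mul_left_cancel₀ (sub_ne_zero.mpr hyz)
    linear_combination (a1 - a2) / 4
  have hg : g₂ Γ = -4 * (x * y + x * z + y * z) := by
    linear_combination -a1 + 4 * (x + y) * hs
  exact ⟨hs, hg, by linear_combination -hx - x * hg + 4 * x ^ 2 * hs⟩

lemma eq_or_eq_or_eq_of_isCubicRoot {Γ : AddSubgroup ℂ} {x y z w : ℂ} (hx : IsCubicRoot Γ x)
    (hy : IsCubicRoot Γ y) (hz : IsCubicRoot Γ z) (hxy : x ≠ y) (hxz : x ≠ z) (hyz : y ≠ z)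
    (hw : IsCubicRoot Γ w) : w = x ∨ w = y ∨ w = z := by
  obtain ⟨hs, h2, h3⟩ := vieta_of_isCubicRoot hx hy hz hxy hxz hyz
  have : (w - x) * ((w - y) * (w - z)) = 0 := by
    simp only [IsCubicRoot, h2, h3] at hw
    linear_combination hw / 4 - w ^ 2 * hs
  simpa [sub_eq_zero] using this

/-- Three half periods already give three distinct roots of a cubic. This lets any root, not only
`e₁`, play the distinguished role for some index-two subgroup. -/
lemma IsCubicRoot.exists_half_period {Γ : AddSubgroup ℂ} (h : IsLattice Γ) {x : ℂ}
    (hx : IsCubicRoot Γ x) : ∃ η ∈ Γ, η ∉ twice Γ ∧ x = wp Γ (η / 2) := by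
  obtain ⟨η₁, m1, η₂, m2, η₃, m3, ⟨n1, n2, n3⟩, h12, h13, h23⟩ :=
    h.exists_distinct_half_period_values
  rcases eq_or_eq_or_eq_of_isCubicRoot (isCubicRoot_wp h m1 n1) (isCubicRoot_wp h m2 n2)
    (isCubicRoot_wp h m3 n3) h12 h13 h23 hx with rfl | rfl | rfl
  exacts [⟨_, m1, n1, rfl⟩, ⟨_, m2, n2, rfl⟩, ⟨_, m3, n3, rfl⟩]

lemma IsIndexTwo.exists_isRootTriple {Γ G : AddSubgroup ℂ} (h : IsLattice Γ)
    (hG : IsIndexTwo G Γ) : ∃ e₁ e₂ e₃, IsRootTriple Γ G e₁ e₂ e₃ := by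
  obtain ⟨ω, hω, hω'⟩ := hG.exists_notMem_twice h
  obtain ⟨η₁, m1, η₂, m2, η₃, m3, ⟨n1, n2, n3⟩, h12, h13, h23⟩ :=
    h.exists_distinct_half_period_values
  have r1 := isCubicRoot_wp h m1 n1
  have r2 := isCubicRoot_wp h m2 n2
  have r3 := isCubicRoot_wp h m3 n3
  rcases eq_or_eq_or_eq_of_isCubicRoot r1 r2 r3 h12 h13 h23
    (isCubicRoot_wp h (hG.1 hω) hω') with e | e | e
  · exact ⟨_, _, _, ⟨r1, r2, r3⟩, ⟨h12, h13, h23⟩, ω, hω, notMem_twice.mp hω', e.symm⟩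
  · exact ⟨_, _, _, ⟨r2, r1, r3⟩, ⟨h12.symm, h23, h13⟩, ω, hω, notMem_twice.mp hω', e.symm⟩
  · exact ⟨_, _, _, ⟨r3, r1, r2⟩, ⟨h13.symm, h23.symm, h12⟩, ω, hω, notMem_twice.mp hω', e.symm⟩

variable {Γ G : AddSubgroup ℂ} {e₁ e₂ e₃ : ℂ}

lemma IsRootTriple.vieta (he : IsRootTriple Γ G e₁ e₂ e₃) :
    e₁ + e₂ + e₃ = 0 ∧ g₂ Γ = -4 * (e₁ * e₂ + e₁ * e₃ + e₂ * e₃) ∧ g₃ Γ = 4 * (e₁ * e₂ * e₃) :=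
  vieta_of_isCubicRoot he.1.1 he.1.2.1 he.1.2.2 he.2.1.1 he.2.1.2.1 he.2.1.2.2

lemma IsRootTriple.invariants (h : IsLattice Γ) (hG : IsIndexTwo G Γ)
    (he : IsRootTriple Γ G e₁ e₂ e₃) :
    g₂ G = 3 * e₁ ^ 2 - (e₂ - e₃) ^ 2 / 4 ∧ g₃ G = e₁ ^ 3 - e₁ * (e₂ - e₃) ^ 2 / 8 := by
  obtain ⟨hs, h2, -⟩ := he.vieta
  obtain ⟨-, -, ω, hω, hω', rfl⟩ := he
  obtain ⟨k2, k3⟩ := isIndexTwo_invariants h hG hω (notMem_twice.mpr hω')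
  set a := wp Γ (ω / 2)
  obtain rfl : e₃ = -a - e₂ := by linear_combination hs
  rw [h2] at k2 k3
  exact ⟨by linear_combination k2 / 4, by linear_combination k3 / 8⟩

lemma IsRootTriple.sixteen_mul_discr (h : IsLattice Γ) (hG : IsIndexTwo G Γ)
    (he : IsRootTriple Γ G e₁ e₂ e₃) :
    16 * discr G = (e₂ - e₃) ^ 4 * ((e₁ - e₂) * (e₁ - e₃)) := by
  obtain ⟨k2, k3⟩ := he.invariants h hG
  obtain rfl : e₃ = -e₁ - e₂ := by linear_combination he.vieta.1
  rw [discr, k2, k3]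
  ring

lemma IsRootTriple.norm_sub_le_of_isOptimal (h : IsLattice Γ) (hG : IsOptimal G Γ)
    (he : IsRootTriple Γ G e₁ e₂ e₃) : ‖e₂ - e₃‖ ≤ ‖e₁ - e₃‖ := by
  obtain ⟨η, hη, hη', e⟩ := he.1.2.1.exists_half_period h
  obtain ⟨G', hG', hηG⟩ := exists_isIndexTwo_of_notMem_twice h hη hη'
  have he' : IsRootTriple Γ G' e₂ e₁ e₃ :=
    ⟨⟨he.1.2.1, he.1.1, he.1.2.2⟩, ⟨he.2.1.1.symm, he.2.1.2.2, he.2.1.2.1⟩,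
      η, hηG, notMem_twice.mp hη', e⟩
  have hle : ‖16 * discr G‖ ≤ ‖16 * discr G'‖ := by
    rw [norm_mul, norm_mul]
    gcongr
    exact hG.2 G' hG'
  rw [he.sixteen_mul_discr h hG.1, he'.sixteen_mul_discr h hG'] at hle
  simp only [norm_mul, norm_pow, norm_sub_rev e₂ e₁] at hle
  have p12 : 0 < ‖e₁ - e₂‖ := norm_pos_iff.mpr (sub_ne_zero.mpr he.2.1.1)
  have p13 : 0 < ‖e₁ - e₃‖ := norm_pos_iff.mpr (sub_ne_zero.mpr he.2.1.2.1)
  have p23 : 0 < ‖e₂ - e₃‖ := norm_pos_iff.mpr (sub_ne_zero.mpr he.2.1.2.2)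
  -- Both discriminants share the factor `‖e₁ - e₂‖ ‖e₁ - e₃‖ ‖e₂ - e₃‖`; cancelling it leaves
  -- cubes.
  have h3 : ‖e₂ - e₃‖ ^ 3 ≤ ‖e₁ - e₃‖ ^ 3 := by
    refine le_of_mul_le_mul_left ?_ (mul_pos (mul_pos p12 p13) p23)
    linarith
  exact le_of_pow_le_pow_left₀ three_ne_zero p13.le h3

lemma IsRootTriple.swap (he : IsRootTriple Γ G e₁ e₂ e₃) : IsRootTriple Γ G e₁ e₃ e₂ :=
  ⟨⟨he.1.1, he.1.2.2, he.1.2.1⟩, ⟨he.2.1.2.1, he.2.1.1, he.2.1.2.2.symm⟩, he.2.2⟩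

end Roots

/-! ### One step of the arithmetic-geometric mean -/

section Contraction

/-- Changing the sign of `β` if necessary makes the cross term in `‖α + β‖²` nonnegative. -/
lemma exists_sq_eq_and_re_nonneg (A B : ℂ) :
    ∃ α β : ℂ, α ^ 2 = A ∧ β ^ 2 = B ∧ ‖A‖ + ‖B‖ ≤ ‖α + β‖ ^ 2 := by
  obtain ⟨α, rfl⟩ := IsAlgClosed.exists_pow_nat_eq A zero_lt_two
  obtain ⟨β, rfl⟩ := IsAlgClosed.exists_pow_nat_eq B zero_lt_two
  rcases le_total 0 (α * (starRingEnd ℂ) β).re with h | h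
  · refine ⟨α, β, rfl, rfl, ?_⟩
    simp only [norm_pow, Complex.sq_norm, Complex.normSq_add]
    linarith
  · refine ⟨α, -β, rfl, neg_sq β, ?_⟩
    simp only [norm_pow, Complex.sq_norm, Complex.normSq_add, Complex.normSq_neg, map_neg, mul_neg,
      Complex.neg_re]
    linarith

/-- The choice of square roots `α, β` with `Re (α * conj β) ≥ 0` in the arithmetic-geometric mean. -/
lemma agm_bounds {A B : ℂ} {m : ℝ} (hm : 0 < m) (hA : m ≤ ‖A‖) (hB : m ≤ ‖B‖) :
    ∃ c : ℂ, c ^ 2 = A * B ∧ m ≤ ‖c‖ ∧ 8 * m * ‖(A + B) / 4 - c / 2‖ ≤ ‖A - B‖ ^ 2 ∧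
      ‖c‖ - ‖(A + B) / 4 - c / 2‖ ≤ ‖(A + B) / 4 + c / 2‖ := by
  obtain ⟨α, β, rfl, rfl, h⟩ := exists_sq_eq_and_re_nonneg A B
  refine ⟨α * β, by ring, ?_, ?_, ?_⟩
  · rw [norm_pow] at hA hB
    refine le_of_pow_le_pow_left₀ two_ne_zero (norm_nonneg _) ?_
    rw [norm_mul, mul_pow, sq m]
    exact mul_le_mul hA hB hm.le (by positivity)
  · have e1 : (α ^ 2 + β ^ 2) / 4 - α * β / 2 = (α - β) ^ 2 / 4 := by ring
    have e2 : α ^ 2 - β ^ 2 = (α + β) * (α - β) := by ring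
    rw [e1, e2, norm_mul, norm_div, norm_pow, mul_pow]
    have : 2 * m ≤ ‖α + β‖ ^ 2 := by linarith
    norm_num
    nlinarith [mul_le_mul_of_nonneg_right this (sq_nonneg ‖α - β‖)]
  · have e : α * β = ((α ^ 2 + β ^ 2) / 4 + α * β / 2) - ((α ^ 2 + β ^ 2) / 4 - α * β / 2) := by ring
    have := norm_sub_le ((α ^ 2 + β ^ 2) / 4 + α * β / 2) ((α ^ 2 + β ^ 2) / 4 - α * β / 2)
    rw [← e] at this
    linarith

lemma IsRootTriple.contraction {Γ G G' : AddSubgroup ℂ} {e₁ e₂ e₃ f₁ f₂ f₃ : ℂ} (h : IsLattice Γ)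
    (hG : IsIndexTwo G Γ) (he : IsRootTriple Γ G e₁ e₂ e₃) (hf : IsRootTriple G G' f₁ f₂ f₃)
    (h12 : ‖f₂ - f₃‖ ≤ ‖f₁ - f₂‖) (h13 : ‖f₂ - f₃‖ ≤ ‖f₁ - f₃‖) {m : ℝ} (hm : 0 < m)
    (hA : m ≤ ‖e₁ - e₂‖) (hB : m ≤ ‖e₁ - e₃‖) (hb : ‖e₂ - e₃‖ ≤ m) :
    8 * m * ‖f₂ - f₃‖ ≤ ‖e₂ - e₃‖ ^ 2 ∧
      8 * m * (m - ‖f₁ - f₂‖) ≤ ‖e₂ - e₃‖ ^ 2 ∧ 8 * m * (m - ‖f₁ - f₃‖) ≤ ‖e₂ - e₃‖ ^ 2 := by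
  obtain ⟨c, hc, hX, hZ, hY⟩ := agm_bounds hm hA hB
  obtain ⟨k2, k3⟩ := he.invariants h hG
  have hs := he.vieta.1
  obtain rfl : e₁ = -e₂ - e₃ := by linear_combination hs
  set a := -e₂ - e₃ with ha
  have hAB : a - e₂ - (a - e₃) = -(e₂ - e₃) := by ring
  rw [hAB, norm_neg] at hZ
  -- Substituting the invariants of `G` factors its cubic, with `c² = (e₁ - e₂)(e₁ - e₃)`. The
  -- pairwise distances of the roots are `‖c‖`, `Y` and `Z` below.
  have root : ∀ x, IsCubicRoot G x → x = -a / 2 ∨ x = a / 4 + c / 2 ∨ x = a / 4 - c / 2 := by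
    intro x hx
    rw [IsCubicRoot, k2, k3] at hx
    have : (x - -a / 2) * ((x - (a / 4 + c / 2)) * (x - (a / 4 - c / 2))) = 0 := by
      linear_combination hx / 4 - (x + a / 2) / 4 * hc
    simpa [sub_eq_zero] using this
  have nX : ‖a / 4 + c / 2 - (a / 4 - c / 2)‖ = ‖c‖ := by congr 1; ring
  have nY : ‖a / 4 + c / 2 - -a / 2‖ = ‖(a - e₂ + (a - e₃)) / 4 + c / 2‖ := by
    congr 1; rw [ha]; ring
  have nZ : ‖a / 4 - c / 2 - -a / 2‖ = ‖(a - e₂ + (a - e₃)) / 4 - c / 2‖ := by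
    congr 1; rw [ha]; ring
  have nX' := norm_sub_rev (a / 4 + c / 2) (a / 4 - c / 2)
  have nY' := norm_sub_rev (a / 4 + c / 2) (-a / 2)
  have nZ' := norm_sub_rev (a / 4 - c / 2) (-a / 2)
  generalize ‖(a - e₂ + (a - e₃)) / 4 + c / 2‖ = Y at *
  generalize ‖(a - e₂ + (a - e₃)) / 4 - c / 2‖ = Z at *
  have hb2 : ‖e₂ - e₃‖ ^ 2 ≤ m ^ 2 := pow_le_pow_left₀ (norm_nonneg _) hb 2
  have hZm : 8 * Z ≤ m := by
    refine le_of_mul_le_mul_left ?_ hm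
    linarith
  have hYm : 8 * m * (m - Y) ≤ ‖e₂ - e₃‖ ^ 2 := by
    have := mul_le_mul_of_nonneg_left (show m - Y ≤ Z by linarith) (show 0 ≤ 8 * m by positivity)
    linarith
  have hXm : 8 * m * (m - ‖c‖) ≤ ‖e₂ - e₃‖ ^ 2 := by
    have := mul_nonneg hm.le (sub_nonneg.mpr hX)
    have := sq_nonneg ‖e₂ - e₃‖
    linarith
  obtain ⟨⟨r1, r2, r3⟩, ⟨d12, d13, d23⟩, -⟩ := hf
  -- The shortest difference must be the one of length `Z`: since `Z ≤ m / 8`, `‖c‖ ≥ m` and `Y ≥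
  -- ‖c‖ - Z`, every other labelling contradicts `h12` or `h13`.
  rcases root f₁ r1 with rfl | rfl | rfl <;> rcases root f₂ r2 with rfl | rfl | rfl <;>
    first
    | exact absurd rfl d12
    | rcases root f₃ r3 with rfl | rfl | rfl <;>
      first
      | exact absurd rfl d13
      | exact absurd rfl d23
      | exact ⟨by linarith, by linarith, by linarith⟩
      | (refine ⟨?_, ?_, ?_⟩ <;> simp_all)

end Contraction

/-! ### Quadratic decay and convergence -/

section Sequences

open Filter Topology

lemma exists_le_mul_pow_two_pow {b m : ℕ → ℝ} (hm : 0 < m 0) (hb : ∀ n, 0 ≤ b n) (hbm : ∀ n, b n ≤ m n)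
    (h1 : ∀ n, 8 * m n * b (n + 1) ≤ b n ^ 2) (h2 : ∀ n, 8 * m n * (m n - m (n + 1)) ≤ b n ^ 2) :
    ∃ C : ℝ, 0 < C ∧ ∀ n, b n ≤ C * (3 / 20) ^ 2 ^ n := by
  -- Since `b ≤ m`, each step loses at most `b / 8` from `m` and divides `b` by at least `8`. The
  -- weight `1 / 6` makes the right side nondecreasing because `1 / 8 + 1 / 48 ≤ 1 / 6`.
  have key : ∀ n, 5 / 6 * m 0 ≤ m n - b n / 6 := by
    intro n
    induction n with
    | zero => linarith [hbm 0]
    | succ n ih =>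
      have hmn : 0 < m n := by linarith [hb n]
      have hsq : b n ^ 2 ≤ m n * b n := by
        rw [sq]; exact mul_le_mul_of_nonneg_right (hbm n) (hb n)
      have b1 : 8 * b (n + 1) ≤ b n := le_of_mul_le_mul_left (by linarith [h1 n]) hmn
      have b2 : 8 * (m n - m (n + 1)) ≤ b n := le_of_mul_le_mul_left (by linarith [h2 n]) hmn
      linarith [hb n]
  -- Here `20 / 3 = 8 * (5 / 6)`: the normalized quantity `b n / (20 / 3 * m 0)` is at most squared
  -- at each step and starts at or below `3 / 20`.
  refine ⟨20 / 3 * m 0, by positivity, fun n ↦ ?_⟩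
  induction n with
  | zero => norm_num; linarith [hbm 0]
  | succ n ih =>
    have h3 : 20 / 3 * m 0 * b (n + 1) ≤ b n ^ 2 := by
      refine le_trans ?_ (h1 n)
      have := key n
      have := hb n
      exact mul_le_mul_of_nonneg_right (by linarith) (hb _)
    have h4 := h3.trans (pow_le_pow_left₀ (hb n) ih 2)
    refine le_of_mul_le_mul_left (h4.trans_eq ?_) (show 0 < 20 / 3 * m 0 by positivity)
    rw [pow_succ 2 n, pow_mul]
    ring

/-- As `2 ^ (n + k) ≥ 2 ^ n + k`, the tail of increments from `n` is dominated by a geometric series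
with first term `K * r ^ 2 ^ n`; the rate is `q = -log r`. -/
lemma convergesQuadraticallyFast_of_norm_sub_le {x : ℕ → ℂ} {K r : ℝ} (hr : 0 < r) (hr1 : r < 1)
    (hK : 0 < K) (h : ∀ n, ‖x (n + 1) - x n‖ ≤ K * r ^ 2 ^ n) : ConvergesQuadraticallyFast x := by
  have hle (n k : ℕ) : K * r ^ 2 ^ (n + k) ≤ K * r ^ 2 ^ n * r ^ k := by
    rw [mul_assoc, ← pow_add]
    refine mul_le_mul_of_nonneg_left (pow_le_pow_of_le_one hr.le hr1.le ?_) hK.le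
    have h1 : k + 1 ≤ 2 ^ k := Nat.lt_two_pow_self
    have h2 : 1 ≤ 2 ^ n := Nat.one_le_two_pow
    rw [pow_add]
    nlinarith
  have hgeo := summable_geometric_of_lt_one hr.le hr1
  have hsum (n : ℕ) : Summable fun k ↦ K * r ^ 2 ^ (n + k) :=
    .of_nonneg_of_le (fun k ↦ by positivity) (hle n) (hgeo.mul_left _)
  have hsum0 : Summable fun k ↦ K * r ^ 2 ^ k := by simpa using hsum 0
  have hdist (n : ℕ) : dist (x n) (x n.succ) ≤ K * r ^ 2 ^ n := by
    rw [dist_comm, dist_eq_norm]; exact h n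
  obtain ⟨l, hl⟩ := cauchySeq_tendsto_of_complete
    (cauchySeq_of_dist_le_of_summable _ hdist hsum0)
  refine ⟨l, hl, K * (1 - r)⁻¹, -Real.log r, ?_, by simpa using Real.log_neg hr hr1, fun n ↦ ?_⟩
  · have : 0 < 1 - r := by linarith
    positivity
  · have hd := dist_le_tsum_of_dist_le_of_tendsto _ hdist hsum0 hl n
    rw [dist_eq_norm] at hd
    refine hd.trans (((hsum n).tsum_le_tsum (hle n) (hgeo.mul_left _)).trans_eq ?_)
    rw [tsum_mul_left, tsum_geometric_of_lt_one hr.le hr1, neg_neg, mul_comm (Real.log r)]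
    have : Real.exp (2 ^ n * Real.log r) = r ^ 2 ^ n := by
      rw [← Real.exp_log (pow_pos hr _), Real.log_pow]
      push_cast
      rfl
    rw [this]
    ring

end Sequences

end Landen

theorem theoremt32 (Γ : ℕ → AddSubgroup ℂ) (hΓ : Landen.IsLattice (Γ 0))
    (hopt : ∀ n : ℕ, Landen.IsOptimal (Γ (n + 1)) (Γ n)) :
    Landen.ConvergesQuadraticallyFast (fun n => Landen.g₂ (Γ n)) ∧
    Landen.ConvergesQuadraticallyFast (fun n => Landen.g₃ (Γ n)) ∧
    ∀ (n : ℕ) (e₁ e₂ e₃ : ℂ), Landen.IsRootTriple (Γ n) (Γ (n + 1)) e₁ e₂ e₃ →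
      Landen.g₂ (Γ (n + 1)) - Landen.g₂ (Γ n) = -(5 / 4) * (e₂ - e₃) ^ 2 ∧
      Landen.g₃ (Γ (n + 1)) - Landen.g₃ (Γ n) = 7 * e₁ / 8 * (e₂ - e₃) ^ 2 := by
  open Landen in
  have hlat : ∀ n, IsLattice (Γ n) := fun n ↦ by
    induction n with
    | zero => exact hΓ
    | succ n ih => exact ih.of_isIndexTwo (hopt n).1
  have hrec : ∀ (n : ℕ) (e₁ e₂ e₃ : ℂ), IsRootTriple (Γ n) (Γ (n + 1)) e₁ e₂ e₃ →
      g₂ (Γ (n + 1)) - g₂ (Γ n) = -(5 / 4) * (e₂ - e₃) ^ 2 ∧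
      g₃ (Γ (n + 1)) - g₃ (Γ n) = 7 * e₁ / 8 * (e₂ - e₃) ^ 2 := by
    intro n e₁ e₂ e₃ he
    obtain ⟨k2, k3⟩ := he.invariants (hlat n) (hopt n).1
    obtain ⟨hs, v2, v3⟩ := he.vieta
    obtain rfl : e₃ = -e₁ - e₂ := by linear_combination hs
    rw [k2, k3, v2, v3]
    constructor <;> ring
  choose e₁ e₂ e₃ he using fun n ↦ (hopt n).1.exists_isRootTriple (hlat n)
  have le3 n := (he n).norm_sub_le_of_isOptimal (hlat n) (hopt n)
  have le2 n : ‖e₂ n - e₃ n‖ ≤ ‖e₁ n - e₂ n‖ := by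
    have := (he n).swap.norm_sub_le_of_isOptimal (hlat n) (hopt n)
    rwa [norm_sub_rev] at this
  have mpos n : 0 < min ‖e₁ n - e₂ n‖ ‖e₁ n - e₃ n‖ :=
    lt_min (norm_pos_iff.mpr (sub_ne_zero.mpr (he n).2.1.1))
      (norm_pos_iff.mpr (sub_ne_zero.mpr (he n).2.1.2.1))
  have hcon n := (he n).contraction (hlat n) (hopt n).1 (he (n + 1)) (le2 (n + 1)) (le3 (n + 1))
    (mpos n) (min_le_left _ _) (min_le_right _ _) (le_min (le2 n) (le3 n))
  obtain ⟨C, hC, hb⟩ := exists_le_mul_pow_two_pow (b := fun n ↦ ‖e₂ n - e₃ n‖)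
    (m := fun n ↦ min ‖e₁ n - e₂ n‖ ‖e₁ n - e₃ n‖) (mpos 0) (fun n ↦ norm_nonneg _)
    -- The loss in `m` is bounded for both long differences, so it holds for whichever attains the
    -- next minimum.
    (fun n ↦ le_min (le2 n) (le3 n)) (fun n ↦ (hcon n).1) (fun n ↦ by
      rcases min_choice ‖e₁ (n + 1) - e₂ (n + 1)‖ ‖e₁ (n + 1) - e₃ (n + 1)‖ with h | h
      · simpa only [h] using (hcon n).2.1
      · simpa only [h] using (hcon n).2.2)
  have hpow (n : ℕ) : ((3 : ℝ) / 20) ^ 2 ^ n ≤ 1 := pow_le_one₀ (by norm_num) (by norm_num)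
  have hb2 (n : ℕ) : ‖e₂ n - e₃ n‖ ^ 2 ≤ C ^ 2 * (3 / 20) ^ 2 ^ n := by
    refine (pow_le_pow_left₀ (norm_nonneg _) (hb n) 2).trans ?_
    rw [mul_pow]
    refine mul_le_mul_of_nonneg_left ?_ (by positivity)
    exact pow_le_of_le_one (by positivity) (hpow n) two_ne_zero
  have hg2 : ConvergesQuadraticallyFast fun n ↦ g₂ (Γ n) := by
    refine convergesQuadraticallyFast_of_norm_sub_le (K := 5 / 4 * C ^ 2) (r := 3 / 20)
      (by norm_num) (by norm_num) (by positivity) fun n ↦ ?_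
    rw [(hrec n _ _ _ (he n)).1, norm_mul, norm_pow, mul_assoc]
    norm_num
    exact hb2 n
  refine ⟨hg2, ?_, hrec⟩
  obtain ⟨l, hl, -⟩ := hg2
  obtain ⟨M, hM⟩ := hl.norm.bddAbove_range
  have hM (n : ℕ) : ‖g₂ (Γ n)‖ ≤ M := hM ⟨n, rfl⟩
  have hM0 : 0 ≤ M := (norm_nonneg _).trans (hM 0)
  -- The increments of `g₃` carry a factor `e₁`, which is bounded because `3 e₁² = g₂ - (e₂ - e₃)²`
  -- and `g₂` converges; the `1` passes from a bound on `‖e₁‖²` to one on `‖e₁‖`.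
  have ha (n : ℕ) : ‖e₁ n‖ ≤ 1 + M + C ^ 2 := by
    obtain ⟨hs, v2, -⟩ := (he n).vieta
    have e : 3 * e₁ n ^ 2 = g₂ (Γ n) - (e₂ n - e₃ n) ^ 2 := by
      rw [v2]
      linear_combination (3 * e₁ n + e₂ n + e₃ n) * hs
    have h3 := norm_sub_le (g₂ (Γ n)) ((e₂ n - e₃ n) ^ 2)
    rw [← e, norm_mul, norm_pow, norm_pow] at h3
    norm_num at h3
    have h4 : ‖e₂ n - e₃ n‖ ^ 2 ≤ C ^ 2 :=
      (hb2 n).trans (mul_le_of_le_one_right (by positivity) (hpow n))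
    nlinarith [hM n, sq_nonneg (‖e₁ n‖ - 1)]
  refine convergesQuadraticallyFast_of_norm_sub_le (K := 7 / 8 * (1 + M + C ^ 2) * C ^ 2)
    (r := 3 / 20) (by norm_num) (by norm_num) (by positivity) fun n ↦ ?_
  rw [(hrec n _ _ _ (he n)).2, norm_mul, norm_pow, mul_assoc]
  refine mul_le_mul ?_ (hb2 n) (by positivity) (by positivity)
  rw [norm_div, norm_mul]
  norm_num
  linarith [ha n]
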